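/- Let $F$ be an algebraically closed field of characteristic zero, let $(q_{ij})_{1\le i,j\le n}$ be a matrix over $F^*=F\setminus\{0\}$, and let $V$ be the braided vector space of diagonal type with basis $x_1,\dots,x_n$ and braiding $C(x_i\otimes x_j)=q_{ij}\,x_j\otimes x_i$. Let $\mathfrak B(V)$ be its Nichols algebra, that is, the quotient of the tensor algebra $T(V)$ by the sum of the kernels of the quantum symmetrizers $S_m=\sum_{\sigma\in\mathbb S_m}T_\sigma$ on $V^{\otimes m}$ ($m\ge 0$). It is graded by $\deg x_i=e_i\in\mathbb Z^n$. For homogeneous $u,v\in\mathfrak B(V)$ put $p_{u,v}=\chi(\deg u,\deg v)$, where $\chi$ is the bicharacter on $\mathbb Z^n$ with $\chi(e_i,e_j)=q_{ij}$. Let the Nichols braided Lie algebra $\mathfrak L(V)$ be the smallest subspace of $\mathfrak B(V)$ that contains $x_1,\dots,x_n$ and is closed under $[u,v]=vu-p_{v,u}\,uv$ for homogeneous $u,v$. Let the pure generalized Dynkin graph have vertices $1,\dots,n$, with distinct $i,j$ joined if and only if $q_{ij}q_{ji}\neq1$. Let $m\ge1$ and let $h_1,\dots,h_m\in\{x_1,\dots,x_n\}$.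 Write $\mu(h_1\cdots h_m)=\{h_1,\dots,h_m\}$ for the set of letters, and call it connected if the subgraph of the pure generalized Dynkin graph induced on (the indices of) these letters is connected. Assume that $p_{h_1,h_1}\ne1$ in case $\mu(h_1\cdots h_m)=\{h_1\}$. Then: 1. (Corollary 2.5) if $h_1\cdots h_m\neq0$ in $\mathfrak B(V)$, then $h_1\cdots h_m\in\mathfrak L(V)$ if and only if $\mu(h_1\cdots h_m)$ is connected; 2. (Theorem 2.4(iv)) if $\mu(h_1\cdots h_m)$ is connected, then $h_1\cdots h_m\in\mathfrak L(V)$, whether or not $h_1\cdots h_m$ is zero in $\mathfrak B(V)$. -/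

import Mathlib

noncomputable section

namespace DiagonalBraiding

variable {F : Type*} [Field F] {n : ℕ}

/- Throughout, `V` is the `F`-vector space with basis `x_1, …, x_n` (indexed by `Fin n`), with the
diagonal braiding `C (x_i ⊗ x_j) = q i j • (x_j ⊗ x_i)`, where `q` is a matrix over `Fˣ`.
The basis of `V^{⊗ m}` consisting of the words `x_{h 0} ⊗ ⋯ ⊗ x_{h (m-1)}` is indexed by
`h : Fin m → Fin n`, so `V^{⊗ m}` is written `(Fin m → Fin n) →₀ F`; the tensor algebra `T(V)` is
`FreeAlgebra F (Fin n)`. -/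

/-- The `m`-th tensor power of `V`, in its basis of words. -/
abbrev TensorPow (F : Type*) [Field F] (n m : ℕ) : Type _ := (Fin m → Fin n) →₀ F

/-- The operator `T_σ` on `V^{⊗ m}` by which the braid lifting the permutation `σ` (the positive
braid of a reduced expression of `σ`) acts through the braiding `C`. The letter in position `k`
is moved to position `σ k`; whenever `k < l` and `σ l < σ k`, the letter `h k` passes `h l` from
left to right exactly once, which by `C (x_i ⊗ x_j) = q i j • (x_j ⊗ x_i)` contributes the factor
`q (h k) (h l)`. -/
def braidOp (q : Fin n → Fin n → Fˣ) {m : ℕ} (σ : Equiv.Perm (Fin m)) :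
    TensorPow F n m →ₗ[F] TensorPow F n m :=
  Finsupp.linearCombination F fun h : Fin m → Fin n =>
    (∏ p : Fin m × Fin m with p.1 < p.2 ∧ σ p.2 < σ p.1, (q (h p.1) (h p.2) : F)) •
      Finsupp.single (h ∘ σ.symm) (1 : F)

/-- The quantum symmetrizer `S_m = ∑ T_σ`, the sum over all permutations of `m` positions. -/
def quantumSymmetrizer (q : Fin n → Fin n → Fˣ) (m : ℕ) :
    TensorPow F n m →ₗ[F] TensorPow F n m :=
  ∑ σ : Equiv.Perm (Fin m), braidOp q σ

/-- The inclusion of `V^{⊗ m}` in the tensor algebra. -/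
def toTensorAlgebra (m : ℕ) : TensorPow F n m →ₗ[F] FreeAlgebra F (Fin n) :=
  Finsupp.linearCombination F fun h : Fin m → Fin n =>
    (List.ofFn fun k => FreeAlgebra.ι F (h k)).prod

/-- The defining relations `t = 0` of the Nichols algebra, for `t` in the kernel of a quantum
symmetrizer. -/
inductive NicholsRel (q : Fin n → Fin n → Fˣ) :
    FreeAlgebra F (Fin n) → FreeAlgebra F (Fin n) → Prop
  | of_ker (m : ℕ) (t : TensorPow F n m) (ht : quantumSymmetrizer q m t = 0) :
      NicholsRel q (toTensorAlgebra m t) 0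

/-- The Nichols algebra `𝔅(V) = T(V) / ⨁ₘ ker S_m`, as the quotient of `T(V)` by the two-sided
ideal that the kernels of the quantum symmetrizers generate (the sum of these kernels is
itself a two-sided ideal). -/
abbrev NicholsAlgebra (q : Fin n → Fin n → Fˣ) : Type _ := RingQuot (NicholsRel q)

/-- The generator `x_i` of the Nichols algebra. -/
def gen (q : Fin n → Fin n → Fˣ) (i : Fin n) : NicholsAlgebra q :=
  RingQuot.mkAlgHom F (NicholsRel q) (FreeAlgebra.ι F i)

/-- The monomial `x_{h 0} x_{h 1} ⋯ x_{h (m-1)}` in the Nichols algebra. -/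
def monomial (q : Fin n → Fin n → Fˣ) {m : ℕ} (h : Fin m → Fin n) : NicholsAlgebra q :=
  (List.ofFn fun k => gen q (h k)).prod

/-- The multidegree of a word: entry `i` counts the occurrences of the letter `x_i`. -/
def wordDeg {m : ℕ} (h : Fin m → Fin n) : Fin n → ℕ :=
  fun i => Fintype.card {k : Fin m // h k = i}

/-- The homogeneous component of multidegree `α` of the Nichols algebra, spanned by the monomials
of multidegree `α`. -/
def homogeneousPart (q : Fin n → Fin n → Fˣ) (α : Fin n → ℕ) : Submodule F (NicholsAlgebra q) :=
  Submodule.span F {u | ∃ (m : ℕ) (h : Fin m → Fin n), wordDeg h = α ∧ u = monomial q h}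

/-- The bicharacter `χ` with `χ (e_i, e_j) = q i j`, on `ℕ^n`, where all degrees of `𝔅(V)` lie. -/
def bichar (q : Fin n → Fin n → Fˣ) (α β : Fin n → ℕ) : Fˣ :=
  ∏ i, ∏ j, q i j ^ (α i * β j)

/-- The Nichols braided Lie algebra `𝔏(V)`: the smallest subspace of `𝔅(V)` which contains the
generators `x_i` of `V` and is closed under `[u, v] = v u - χ (deg v, deg u) u v` for homogeneous
elements `u`, `v`. -/
def nicholsBraidedLie (q : Fin n → Fin n → Fˣ) : Submodule F (NicholsAlgebra q) :=
  sInf {W | (∀ i, gen q i ∈ W) ∧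
    ∀ (α β : Fin n → ℕ) (u v : NicholsAlgebra q),
      u ∈ W → v ∈ W → u ∈ homogeneousPart q α → v ∈ homogeneousPart q β →
        v * u - (bichar q β α : F) • (u * v) ∈ W}

/-- The pure generalized Dynkin graph: distinct vertices `i`, `j` are joined iff
`q i j * q j i ≠ 1`. -/
def pureDynkinGraph (q : Fin n → Fin n → Fˣ) : SimpleGraph (Fin n) where
  Adj i j := i ≠ j ∧ q i j * q j i ≠ 1
  symm := ⟨fun i j hij => ⟨hij.1.symm, by rw [mul_comm]; exact hij.2⟩⟩
  loopless := ⟨fun _ hi => hi.1 rfl⟩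

/-- The set of letters `μ(h) = {h 0, …, h (m-1)}` of a word is connected: the subgraph of the pure
generalized Dynkin graph generated by it is connected. -/
def LettersConnected (q : Fin n → Fin n → Fˣ) {m : ℕ} (h : Fin m → Fin n) : Prop :=
  ((pureDynkinGraph q).induce (Set.range h)).Connected

end DiagonalBraiding

end

/-!
Work in `𝔅(V) / 𝔏(V)`. Closure under the bracket says that a word `u v` whose two factors lie in
`𝔏(V)` can be rotated to `v u` at the cost of the factor `χ(v, u)`. By induction on the length all
shorter admissible words lie in `𝔏(V)`; here a word is admissible if its letters are connected and
it is not `x_i ^ k` with `2 ≤ k` and `q i i = 1`.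

*Connected words with two distinct letters.* The rotation rule holds for every admissible `u`, with
no hypothesis on `v`, as long as `u v` is connected with at least two distinct letters
(`monomialClass_rotate`). Indeed, a disconnected `v` is, up to a unit, a product `v₁ v₂` of words
not joined to each other, because letters which are not joined `q`-commute in `𝔅(V)` (`gen_mul_gen`);
`v₁` and `v₂` are rotated in turn, and the factors for their passing each other cancel. A power of a
letter with `q i i = 1` is rotated letter by letter. Now let `i`, `j` be joined. In `i j v` the two
letters can be rotated one at a time or as a block; the resulting factors differ by
`q i j * q j i ≠ 1`, so the class of `i j v` vanishes (`monomialClass_cons_cons_eq_zero`). Every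
connected word with two distinct letters becomes of this form by `q`-commutations and rotations.

*Powers of a letter with `q i i ≠ 1`.* The bracket of `x_i ^ k` and `x_i` is
`(1 - q i i ^ k) x_i ^ (k + 1)`, and `x_i ^ k = 0` if `q i i ^ k = 1`, because the quantum
symmetrizer acts on it by the inversion generating function of the symmetric group, which has the
factor `1 + q i i + ⋯ + q i i ^ (k - 1)` (`gen_pow_eq_zero`).

*Disconnected words.* The quantum symmetrizers preserve the multidegree, so `𝔅(V)` is graded by
`ℕ^n` (`coaction`). The bracket of homogeneous elements whose degrees are not joined vanishes
(`bracket_eq_zero`), so `𝔏(V)` has no nonzero element of disconnected degree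
(`nicholsBraidedLie_le_connectedPart`).
-/

namespace DiagonalBraiding

variable {F : Type*} [Field F] {n : ℕ}

/-! ### Words, multidegrees and the bicharacter -/

/-- The monomial of the Nichols algebra spelled by a list of letters. -/
noncomputable def listMonomial (q : Fin n → Fin n → Fˣ) (w : List (Fin n)) : NicholsAlgebra q :=
  (w.map (gen q)).prod

/-- The multidegree of a list of letters. -/
def listDeg (w : List (Fin n)) : Fin n → ℕ := fun i => w.count i

/-- The bicharacter `χ`, evaluated at the multidegrees of two lists of letters. -/
noncomputable def chi (q : Fin n → Fin n → Fˣ) (u v : List (Fin n)) : Fˣ :=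
  bichar q (listDeg u) (listDeg v)

theorem listMonomial_cons (q : Fin n → Fin n → Fˣ) (i : Fin n) (w : List (Fin n)) :
    listMonomial q (i :: w) = gen q i * listMonomial q w := by
  simp [listMonomial]

theorem listMonomial_append (q : Fin n → Fin n → Fˣ) (u v : List (Fin n)) :
    listMonomial q (u ++ v) = listMonomial q u * listMonomial q v := by
  simp [listMonomial]

theorem listMonomial_singleton (q : Fin n → Fin n → Fˣ) (i : Fin n) :
    listMonomial q [i] = gen q i := by
  simp [listMonomial]

theorem listMonomial_ofFn (q : Fin n → Fin n → Fˣ) {m : ℕ} (h : Fin m → Fin n) :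
    listMonomial q (List.ofFn h) = monomial q h := by
  simp only [listMonomial, monomial, List.map_ofFn]
  rfl

theorem listMonomial_replicate (q : Fin n → Fin n → Fˣ) (k : ℕ) (i : Fin n) :
    listMonomial q (List.replicate k i) = gen q i ^ k := by
  simp [listMonomial]

theorem wordDeg_eq_listDeg {m : ℕ} (h : Fin m → Fin n) : wordDeg h = listDeg (List.ofFn h) := by
  funext i
  simp only [wordDeg, listDeg, Fintype.card_subtype]
  induction m with
  | zero => simp
  | succ m ih =>
    rw [Fin.card_filter_univ_succ', List.ofFn_succ, List.count_cons, add_comm]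
    have := ih (fun k => h k.succ)
    simp only [this, beq_iff_eq]

theorem listDeg_append (u v : List (Fin n)) : listDeg (u ++ v) = listDeg u + listDeg v := by
  funext i; simp [listDeg]

theorem bichar_add_left (q : Fin n → Fin n → Fˣ) (α β γ : Fin n → ℕ) :
    bichar q (α + β) γ = bichar q α γ * bichar q β γ := by
  simp only [bichar, ← Finset.prod_mul_distrib, Pi.add_apply, add_mul, pow_add]

theorem bichar_add_right (q : Fin n → Fin n → Fˣ) (α β γ : Fin n → ℕ) :
    bichar q γ (α + β) = bichar q γ α * bichar q γ β := by
  simp only [bichar, ← Finset.prod_mul_distrib, Pi.add_apply, mul_add, pow_add]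

theorem chi_append_left (q : Fin n → Fin n → Fˣ) (u v w : List (Fin n)) :
    chi q (u ++ v) w = chi q u w * chi q v w := by
  simp only [chi, listDeg_append, bichar_add_left]

theorem chi_append_right (q : Fin n → Fin n → Fˣ) (u v w : List (Fin n)) :
    chi q w (u ++ v) = chi q w u * chi q w v := by
  simp only [chi, listDeg_append, bichar_add_right]

theorem chi_nil_left (q : Fin n → Fin n → Fˣ) (w : List (Fin n)) : chi q [] w = 1 := by
  simp [chi, bichar, listDeg]

theorem chi_nil_right (q : Fin n → Fin n → Fˣ) (w : List (Fin n)) : chi q w [] = 1 := by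
  simp [chi, bichar, listDeg]

theorem chi_singleton (q : Fin n → Fin n → Fˣ) (i j : Fin n) : chi q [i] [j] = q i j := by
  unfold chi bichar listDeg
  rw [Finset.prod_eq_single i, Finset.prod_eq_single j]
  · simp
  · intro b _ hb; simp [Ne.symm hb]
  · simp
  · intro b _ hb; simp [List.count_singleton, Ne.symm hb]
  · simp

theorem chi_cons_left (q : Fin n → Fin n → Fˣ) (i : Fin n) (v w : List (Fin n)) :
    chi q (i :: v) w = chi q [i] w * chi q v w :=
  chi_append_left q [i] v w

theorem chi_cons_right (q : Fin n → Fin n → Fˣ) (i : Fin n) (v w : List (Fin n)) :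
    chi q w (i :: v) = chi q w [i] * chi q w v :=
  chi_append_right q [i] v w

theorem listMonomial_mem_homogeneousPart (q : Fin n → Fin n → Fˣ) (w : List (Fin n)) :
    listMonomial q w ∈ homogeneousPart q (listDeg w) :=
  Submodule.subset_span ⟨w.length, w.get, by rw [wordDeg_eq_listDeg, List.ofFn_get],
    by rw [← listMonomial_ofFn, List.ofFn_get]⟩

/-- The homogeneous component of multidegree `α` is spanned by the monomials of lists. -/
theorem homogeneousPart_eq_span (q : Fin n → Fin n → Fˣ) (α : Fin n → ℕ) :
    homogeneousPart q α = Submodule.span F {u | ∃ w, listDeg w = α ∧ u = listMonomial q w} := by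
  refine le_antisymm (Submodule.span_le.2 ?_) (Submodule.span_le.2 ?_)
  · rintro _ ⟨m, h, rfl, rfl⟩
    exact Submodule.subset_span
      ⟨List.ofFn h, (wordDeg_eq_listDeg h).symm, (listMonomial_ofFn q h).symm⟩
  · rintro _ ⟨w, rfl, rfl⟩
    exact listMonomial_mem_homogeneousPart q w

theorem gen_mem_nicholsBraidedLie (q : Fin n → Fin n → Fˣ) (i : Fin n) :
    gen q i ∈ nicholsBraidedLie q := by
  rw [nicholsBraidedLie, Submodule.mem_sInf]
  exact fun W hW => hW.1 i

theorem bracket_mem_nicholsBraidedLie (q : Fin n → Fin n → Fˣ) {u v : List (Fin n)}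
    (hu : listMonomial q u ∈ nicholsBraidedLie q) (hv : listMonomial q v ∈ nicholsBraidedLie q) :
    listMonomial q (v ++ u) - (chi q v u : F) • listMonomial q (u ++ v) ∈ nicholsBraidedLie q := by
  rw [listMonomial_append, listMonomial_append]
  rw [nicholsBraidedLie, Submodule.mem_sInf] at *
  exact fun W hW => hW.2 _ _ _ _ (hu W hW) (hv W hW) (listMonomial_mem_homogeneousPart q u)
    (listMonomial_mem_homogeneousPart q v)

/-! ### Relations of the Nichols algebra -/

theorem mkAlgHom_toTensorAlgebra_single (q : Fin n → Fin n → Fˣ) {m : ℕ} (h : Fin m → Fin n)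
    (c : F) :
    RingQuot.mkAlgHom F (NicholsRel q) (toTensorAlgebra m (Finsupp.single h c)) =
      c • monomial q h := by
  simp only [toTensorAlgebra, Finsupp.linearCombination_single, map_smul, map_list_prod,
    List.map_ofFn, monomial]
  rfl

theorem mkAlgHom_toTensorAlgebra_eq_zero (q : Fin n → Fin n → Fˣ) {m : ℕ} {t : TensorPow F n m}
    (ht : quantumSymmetrizer q m t = 0) :
    RingQuot.mkAlgHom F (NicholsRel q) (toTensorAlgebra m t) = 0 := by
  rw [RingQuot.mkAlgHom_rel F (NicholsRel.of_ker m t ht), map_zero]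

theorem gen_mul_gen (q : Fin n → Fin n → Fˣ) {i j : Fin n} (hij : q i j * q j i = 1) :
    gen q i * gen q j = (q i j : F) • (gen q j * gen q i) := by
  have key : quantumSymmetrizer q 2
      (Finsupp.single ![i, j] (1 : F) - Finsupp.single ![j, i] (q i j : F)) = 0 := by
    have h1 : (![i, j] ∘ (Equiv.swap (0 : Fin 2) 1).symm) = ![j, i] := by
      funext k; fin_cases k <;> simp
    have h2 : (![j, i] ∘ (Equiv.swap (0 : Fin 2) 1).symm) = ![i, j] := by
      funext k; fin_cases k <;> simp
    have hu : (Finset.univ : Finset (Equiv.Perm (Fin 2))) = {1, Equiv.swap 0 1} := by decide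
    have f1 : (Finset.univ.filter fun p : Fin 2 × Fin 2 =>
        p.1 < p.2 ∧ (1 : Equiv.Perm (Fin 2)) p.2 < (1 : Equiv.Perm (Fin 2)) p.1) = ∅ := by decide
    have f2 : (Finset.univ.filter fun p : Fin 2 × Fin 2 =>
        p.1 < p.2 ∧ (Equiv.swap (0 : Fin 2) 1) p.2 < (Equiv.swap (0 : Fin 2) 1) p.1) = {(0, 1)} := by
      decide
    have hij' : (q i j : F) * q j i = 1 := by rw [← Units.val_mul, hij, Units.val_one]
    have hne : (1 : Equiv.Perm (Fin 2)) ∉ ({Equiv.swap 0 1} : Finset _) := by decide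
    have e1 : (![i, j] ∘ (1 : Equiv.Perm (Fin 2)).symm) = ![i, j] := rfl
    have e2 : (![j, i] ∘ (1 : Equiv.Perm (Fin 2)).symm) = ![j, i] := rfl
    simp only [quantumSymmetrizer, hu, Finset.sum_insert hne, Finset.sum_singleton,
      LinearMap.add_apply, map_sub, braidOp, Finsupp.linearCombination_single, f1, f2, h1, h2,
      Finset.prod_empty, Finset.prod_singleton, e1, e2]
    simp [hij']
    abel
  have := mkAlgHom_toTensorAlgebra_eq_zero q key
  rw [map_sub, map_sub, mkAlgHom_toTensorAlgebra_single, mkAlgHom_toTensorAlgebra_single,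
    sub_eq_zero] at this
  simpa [monomial] using this

/-- The bijection `(p, τ) ↦ σ` where `σ 0 = p` and `τ` is the pattern of the other values. -/
noncomputable def consPerm (k : ℕ) (x : Fin (k + 1) × Equiv.Perm (Fin k)) :
    Equiv.Perm (Fin (k + 1)) :=
  x.1.cycleRange.symm * Equiv.Perm.decomposeFin.symm (0, x.2)

theorem consPerm_zero (k : ℕ) (x : Fin (k + 1) × Equiv.Perm (Fin k)) : consPerm k x 0 = x.1 := by
  simp [consPerm]

theorem consPerm_succ (k : ℕ) (x : Fin (k + 1) × Equiv.Perm (Fin k)) (j : Fin k) :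
    consPerm k x j.succ = x.1.succAbove (x.2 j) := by
  simp [consPerm]

theorem consPerm_bijective (k : ℕ) : Function.Bijective (consPerm k) := by
  rw [Fintype.bijective_iff_injective_and_card]
  refine ⟨fun x y hxy => ?_, ?_⟩
  · have h0 : x.1 = y.1 := by rw [← consPerm_zero, hxy, consPerm_zero]
    refine Prod.ext h0 (Equiv.ext fun j => ?_)
    have := consPerm_succ k x j
    rw [hxy, consPerm_succ, h0] at this
    exact (Fin.succAbove_right_injective this).symm
  · simp [Fintype.card_perm, Nat.factorial_succ]

theorem prod_inversions_consPerm (r : F) (k : ℕ) (x : Fin (k + 1) × Equiv.Perm (Fin k)) :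
    (∏ p : Fin (k + 1) × Fin (k + 1) with p.1 < p.2 ∧ consPerm k x p.2 < consPerm k x p.1, r) =
      r ^ (x.1 : ℕ) * ∏ p : Fin k × Fin k with p.1 < p.2 ∧ x.2 p.2 < x.2 p.1, r := by
  simp only [Finset.prod_filter, Fintype.prod_prod_type]
  rw [Fin.prod_univ_succ]
  congr 1
  · rw [Fin.prod_univ_succ]
    simp only [consPerm_zero, consPerm_succ, lt_irrefl, false_and, if_false, one_mul,
      Fin.succ_pos, true_and, Fin.succAbove_lt_iff_castSucc_lt]
    rw [Equiv.prod_comp x.2 (fun j => if j.castSucc < x.1 then r else 1), ← Finset.prod_filter,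
      Finset.prod_const]
    congr 1
    have := Fin.card_Iio x.1
    rw [← this, ← Finset.card_map Fin.castSuccEmb]
    congr 1
    ext j
    simp only [Finset.mem_map, Finset.mem_filter, Finset.mem_univ, true_and, Finset.mem_Iio,
      Fin.castSuccEmb_apply]
    constructor
    · rintro ⟨a, ha, rfl⟩; exact ha
    · intro hj
      exact ⟨j.castPred (Fin.ne_last_of_lt hj), by simpa using hj, by simp⟩
  · refine Finset.prod_congr rfl fun a _ => ?_
    rw [Fin.prod_univ_succ]
    simp [consPerm_succ]

/-- A factor `1 + r + ⋯ + r ^ (k - 1) = 0` splits off the inversion generating function of `S_k`. -/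
theorem sum_prod_inversions_eq_zero {r : F} (hr : r ≠ 1) {k : ℕ} (hk : 0 < k) (hrk : r ^ k = 1) :
    (∑ σ : Equiv.Perm (Fin k), ∏ p : Fin k × Fin k with p.1 < p.2 ∧ σ p.2 < σ p.1, r) = 0 := by
  obtain ⟨k, rfl⟩ := Nat.exists_eq_succ_of_ne_zero hk.ne'
  rw [← (Equiv.ofBijective _ (consPerm_bijective k)).sum_comp]
  simp only [Equiv.ofBijective_apply, prod_inversions_consPerm]
  rw [Fintype.sum_prod_type]
  simp only [← Finset.mul_sum, ← Finset.sum_mul]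
  rw [Fin.sum_univ_eq_sum_range (fun j => r ^ j), geom_sum_eq hr, hrk]
  simp

theorem gen_pow_eq_zero (q : Fin n → Fin n → Fˣ) {i : Fin n} (hi : q i i ≠ 1) {k : ℕ}
    (hk : 0 < k) (hqk : q i i ^ k = 1) : gen q i ^ k = 0 := by
  have key : quantumSymmetrizer q k (Finsupp.single (fun _ => i) (1 : F)) = 0 := by
    have hc : ∀ σ : Equiv.Perm (Fin k), ((fun _ => i) ∘ σ.symm : Fin k → Fin n) = fun _ => i :=
      fun σ => rfl
    simp only [quantumSymmetrizer, LinearMap.sum_apply, braidOp,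
      Finsupp.linearCombination_single, one_smul, hc]
    rw [← Finset.sum_smul, sum_prod_inversions_eq_zero _ hk _, zero_smul]
    · simpa using hi
    · rw [← Units.val_pow_eq_pow_val, hqk, Units.val_one]
  have := mkAlgHom_toTensorAlgebra_eq_zero q key
  rwa [mkAlgHom_toTensorAlgebra_single, one_smul, ← listMonomial_ofFn, List.ofFn_const,
    listMonomial_replicate] at this

/-! ### Connected words -/

/-- A word is connected if it is nonempty and every partition of the vertices into two classes
which both occur in the word is crossed by an edge between letters of the word. Since the classes
are disjoint, the condition `a ≠ b` of the Dynkin graph need not be repeated. -/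
def ListConnected (q : Fin n → Fin n → Fˣ) (w : List (Fin n)) : Prop :=
  w ≠ [] ∧ ∀ P : Fin n → Bool, (∃ a ∈ w, P a = true) → (∃ b ∈ w, P b = false) →
    ∃ a ∈ w, ∃ b ∈ w, P a = true ∧ P b = false ∧ q a b * q b a ≠ 1

/-- A connected word with at least two distinct letters. -/
def ListConnectedNontrivial (q : Fin n → Fin n → Fˣ) (w : List (Fin n)) : Prop :=
  ListConnected q w ∧ ∀ i, ∃ x ∈ w, x ≠ i

/-- The words whose monomials lie in `𝔏(V)` by virtue of their letters: connected words, except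
the powers `x_i ^ k` with `2 ≤ k` and `q i i = 1`. -/
def ListAdmissible (q : Fin n → Fin n → Fˣ) (w : List (Fin n)) : Prop :=
  ListConnected q w ∧ ∀ i, (∀ x ∈ w, x = i) → w.length = 1 ∨ q i i ≠ 1

section Words

variable {q : Fin n → Fin n → Fˣ} {u v w : List (Fin n)}

theorem ListConnected.congr (hw : ListConnected q w) (h : ∀ x, x ∈ w ↔ x ∈ v) :
    ListConnected q v := by
  refine ⟨?_, ?_⟩
  · rintro rfl
    obtain ⟨x, hx⟩ := List.exists_mem_of_ne_nil w hw.1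
    simpa using (h x).1 hx
  · simpa only [h] using hw.2

theorem ListConnectedNontrivial.congr (hw : ListConnectedNontrivial q w)
    (h : ∀ x, x ∈ w ↔ x ∈ v) : ListConnectedNontrivial q v :=
  ⟨hw.1.congr h, by simpa only [h] using hw.2⟩

theorem ListConnectedNontrivial.admissible (hw : ListConnectedNontrivial q w) :
    ListAdmissible q w :=
  ⟨hw.1, fun i hi => by
    obtain ⟨x, hx, hxi⟩ := hw.2 i
    exact absurd (hi x hx) hxi⟩

theorem listAdmissible_singleton (q : Fin n → Fin n → Fˣ) (i : Fin n) :
    ListAdmissible q [i] := by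
  refine ⟨⟨by simp, ?_⟩, by simp⟩
  intro P
  simp only [List.mem_singleton, exists_eq_left]
  intro h1 h2
  simp [h1] at h2

theorem listAdmissible_pair {i j : Fin n} (hij : q i j * q j i ≠ 1) :
    ListAdmissible q [i, j] := by
  refine ⟨⟨by simp, fun P h1 h2 => ?_⟩, fun k hk => Or.inr ?_⟩
  · simp only [List.mem_cons, List.not_mem_nil, or_false, exists_eq_or_imp, exists_eq_left]
      at h1 h2 ⊢
    have hji : q j i * q i j ≠ 1 := by rwa [mul_comm]
    cases hi : P i <;> cases hj : P j <;> simp_all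
  · obtain rfl : i = k := hk i (by simp)
    obtain rfl : j = i := hk j (by simp)
    rintro h
    simp [h] at hij

/-- If the word `u ++ v` and its factor `u` are connected, every union of connected components of
`v` is attached to `u`. -/
theorem ListConnected.append_filter (huv : ListConnected q (u ++ v)) (hu : ListConnected q u)
    {P : Fin n → Bool}
    (hP : ∀ a ∈ v, ∀ b ∈ v, P a = true → P b = false → q a b * q b a = 1) :
    ListConnected q (u ++ v.filter P) := by
  refine ⟨by simp [hu.1], ?_⟩
  -- It suffices to treat a partition with `u` contained in the class `R = false`.
  have key : ∀ R : Fin n → Bool, (∃ a ∈ u ++ v.filter P, R a = true) → (∀ b ∈ u, R b = false) →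
      ∃ a ∈ u ++ v.filter P, ∃ b ∈ u ++ v.filter P,
        R a = true ∧ R b = false ∧ q a b * q b a ≠ 1 := by
    intro R ⟨a, ha, hRa⟩ hR
    have hav : a ∈ v.filter P := by
      rcases List.mem_append.1 ha with h | h
      · simp [hR a h] at hRa
      · exact h
    obtain ⟨y, hy⟩ := List.exists_mem_of_ne_nil u hu.1
    obtain ⟨c, hc, d, hd, hc1, hd1, hcd⟩ := huv.2 (fun x => R x && P x && decide (x ∈ v))
      ⟨a, by simp_all, by simp_all⟩ ⟨y, by simp [hy], by simp [hR y hy]⟩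
    simp only [Bool.and_eq_true, decide_eq_true_eq] at hc1
    refine ⟨c, by simp [hc1], d, ?_, hc1.1.1, ?_, hcd⟩
    · by_contra hd2
      simp only [List.mem_append, List.mem_filter, not_or, not_and, Bool.not_eq_true] at hd2 hd
      have hdv := hd.resolve_left hd2.1
      exact hcd (hP c hc1.2 d hdv hc1.1.2 (hd2.2 hdv))
    · rcases List.mem_append.1 hd with h | h
      · exact hR d h
      · by_contra hRd
        have hRd' : R d = true := by simpa using hRd
        have hPd : P d = false := by simpa [h, hRd'] using hd1
        exact hcd (hP c hc1.2 d h hc1.1.2 hPd)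
  intro R h1 h2
  by_cases hut : ∃ a ∈ u, R a = true
  · by_cases huf : ∃ b ∈ u, R b = false
    · obtain ⟨a, ha, b, hb, h⟩ := hu.2 R hut huf
      exact ⟨a, by simp [ha], b, by simp [hb], h⟩
    · obtain ⟨b, hb, a, ha, h3, h4, h5⟩ := key (fun x => !R x) (by simpa using h2)
        (by simpa using huf)
      exact ⟨a, ha, b, hb, by simpa using h4, by simpa using h3, by rwa [mul_comm]⟩
  · exact key R h1 (by simpa using hut)

theorem ListConnectedNontrivial.append_filter (huv : ListConnectedNontrivial q (u ++ v))
    (hu : ListConnected q u) {P : Fin n → Bool} (ht : ∃ a ∈ v, P a = true)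
    (hP : ∀ a ∈ v, ∀ b ∈ v, P a = true → P b = false → q a b * q b a = 1) :
    ListConnectedNontrivial q (u ++ v.filter P) := by
  refine ⟨huv.1.append_filter hu hP, fun i => ?_⟩
  by_contra! hi
  obtain ⟨a, ha, hPa⟩ := ht
  obtain rfl : a = i := hi a (by simp [ha, hPa])
  obtain ⟨b, hb, hba⟩ := huv.2 a
  obtain ⟨c, hc, d, hd, hc1, hd1, hcd⟩ := huv.1.2 (fun x => decide (x = a))
    ⟨a, by simp [ha], by simp⟩ ⟨b, hb, by simp [hba]⟩
  obtain rfl : c = a := by simpa using hc1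
  have hdc : d ≠ c := by simpa using hd1
  have hdn : d ∉ u ++ v.filter P := fun h => hdc (hi d h)
  simp only [List.mem_append, List.mem_filter, not_or, not_and, Bool.not_eq_true] at hdn hd
  have hdv := hd.resolve_left hdn.1
  exact hcd (hP c ha d hdv hPa (hdn.2 hdv))

/-- A word with a pair of joined letters factors with such a pair of letters, none of the letters
between them being joined to the first. -/
theorem exists_factorization_of_edge (hw : ¬ w.Pairwise fun i j => q i j * q j i = 1) :
    ∃ a i z j c, w = a ++ i :: (z ++ j :: c) ∧ q i j * q j i ≠ 1 ∧
      ∀ y ∈ z, q i y * q y i = 1 := by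
  induction w with
  | nil => simp at hw
  | cons x w ih =>
    by_cases hx : ∀ y ∈ w, q x y * q y x = 1
    · obtain ⟨a, i, z, j, c, h, h'⟩ := ih fun h => hw (List.pairwise_cons.2 ⟨hx, h⟩)
      exact ⟨x :: a, i, z, j, c, by simp [h], h'⟩
    · have hx' : ∃ z j c, w = z ++ j :: c ∧ q x j * q j x ≠ 1 ∧ ∀ y ∈ z, q x y * q y x = 1 := by
        clear ih hw
        induction w with
        | nil => simp at hx
        | cons y w ih =>
          by_cases hy : q x y * q y x = 1
          · obtain ⟨z, j, c, h, h1, h2⟩ := ih fun h => hx (by simpa [hy] using h)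
            exact ⟨y :: z, j, c, by simp [h], h1, by simpa [hy] using h2⟩
          · exact ⟨[], y, w, rfl, hy, by simp⟩
      obtain ⟨z, j, c, h, h'⟩ := hx'
      exact ⟨[], x, z, j, c, by simp [h], h'⟩

theorem ListConnectedNontrivial.not_pairwise (hw : ListConnectedNontrivial q w) :
    ¬ w.Pairwise fun i j => q i j * q j i = 1 := by
  intro hp
  obtain ⟨a, ha⟩ := List.exists_mem_of_ne_nil w hw.1.1
  obtain ⟨b, hb, hba⟩ := hw.2 a
  obtain ⟨c, hc, d, hd, hc1, hd1, hcd⟩ := hw.1.2 (fun x => decide (x = a))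
    ⟨a, ha, by simp⟩ ⟨b, hb, by simp [hba]⟩
  have hne : c ≠ d := by rintro rfl; simp [hc1] at hd1
  have : Std.Symm fun i j => q i j * q j i = 1 := ⟨fun _ _ h => by rwa [mul_comm]⟩
  exact hcd (hp.forall hc hd hne)

/-! ### Commutation of letters that are not joined -/

theorem listMonomial_cons_comm {i : Fin n} (h : ∀ b ∈ v, q i b * q b i = 1) :
    listMonomial q (i :: v) = chi q [i] v • listMonomial q (v ++ [i]) := by
  induction v with
  | nil => simp [chi_nil_right]
  | cons y v ih =>
    rw [listMonomial_cons, listMonomial_cons, ← mul_assoc, gen_mul_gen q (h y (by simp)),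
      smul_mul_assoc, mul_assoc, ← listMonomial_cons, ih fun b hb => h b (by simp [hb]),
      List.cons_append, listMonomial_cons, chi_cons_right, chi_singleton, mul_smul,
      mul_smul_comm]
    rfl

theorem listMonomial_append_comm (h : ∀ a ∈ u, ∀ b ∈ v, q a b * q b a = 1) :
    listMonomial q (u ++ v) = chi q u v • listMonomial q (v ++ u) := by
  induction u generalizing v with
  | nil => simp [chi_nil_left]
  | cons x u ih =>
    rw [List.cons_append, listMonomial_cons, ih fun a ha => h a (by simp [ha]), mul_smul_comm,
      ← listMonomial_cons, ← List.cons_append, listMonomial_append,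
      listMonomial_cons_comm (h x (by simp)), smul_mul_assoc, ← listMonomial_append, smul_smul,
      chi_cons_left q x u v, mul_comm]
    simp

theorem chi_mul_chi_eq_one (h : ∀ a ∈ u, ∀ b ∈ v, q a b * q b a = 1) :
    chi q u v * chi q v u = 1 := by
  induction u with
  | nil => simp [chi_nil_left, chi_nil_right]
  | cons x u ih =>
    have hx : chi q [x] v * chi q v [x] = 1 := by
      have hx := h x (by simp)
      clear ih h
      induction v with
      | nil => simp [chi_nil_left, chi_nil_right]
      | cons y v ih =>
        rw [chi_cons_left q y, chi_cons_right q y, mul_mul_mul_comm,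
          ih fun b hb => hx b (by simp [hb]), chi_singleton, chi_singleton, hx y (by simp),
          one_mul]
    rw [chi_cons_left q x u, chi_cons_right q x u, mul_mul_mul_comm, hx,
      ih fun a ha => h a (by simp [ha]), one_mul]

/-- Sorting the letters of a word into two classes that are not joined to each other changes the
monomial by a unit only. -/
theorem exists_listMonomial_filter (P : Fin n → Bool)
    (hP : ∀ a ∈ w, ∀ b ∈ w, P a = true → P b = false → q a b * q b a = 1) :
    ∃ c : Fˣ, listMonomial q w = c • listMonomial q (w.filter P ++ w.filter fun x => !P x) := by
  induction w with
  | nil => exact ⟨1, by simp⟩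
  | cons x w ih =>
    obtain ⟨c, hc⟩ := ih fun a ha b hb => hP a (by simp [ha]) b (by simp [hb])
    rw [listMonomial_cons, hc, mul_smul_comm]
    cases hx : P x
    · refine ⟨c * chi q [x] (w.filter P), ?_⟩
      have hcomm := listMonomial_cons_comm (q := q) (i := x) (v := w.filter P) fun b hb => by
        rw [mul_comm]
        exact hP b (by simp_all) x (by simp) (by simp_all) hx
      rw [listMonomial_append, ← mul_assoc, ← listMonomial_cons, hcomm, smul_mul_assoc,
        ← listMonomial_append, smul_smul]
      simp [hx]
    · exact ⟨c, by simp [hx, listMonomial_cons]⟩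

/-! ### Rotation of words modulo the braided Lie algebra -/

/-- The class of a monomial in `𝔅(V) / 𝔏(V)`. -/
noncomputable def monomialClass (q : Fin n → Fin n → Fˣ) (w : List (Fin n)) :
    NicholsAlgebra q ⧸ nicholsBraidedLie q :=
  (nicholsBraidedLie q).mkQ (listMonomial q w)

theorem monomialClass_eq_zero : monomialClass q w = 0 ↔ listMonomial q w ∈ nicholsBraidedLie q := by
  simp [monomialClass]

theorem monomialClass_of_smul {c : Fˣ} (h : listMonomial q v = c • listMonomial q w) :
    monomialClass q v = c • monomialClass q w := by
  rw [monomialClass, h, Units.smul_def, map_smul]; rfl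

theorem monomialClass_bracket (hu : listMonomial q u ∈ nicholsBraidedLie q)
    (hv : listMonomial q v ∈ nicholsBraidedLie q) :
    monomialClass q (v ++ u) = chi q v u • monomialClass q (u ++ v) := by
  have := bracket_mem_nicholsBraidedLie q hu hv
  rw [← Submodule.ker_mkQ (nicholsBraidedLie q), LinearMap.mem_ker, map_sub, map_smul,
    sub_eq_zero] at this
  exact this

theorem chi_singleton_replicate {i : Fin n} (hi : q i i = 1) (k : ℕ) :
    chi q [i] (List.replicate k i) = 1 := by
  induction k with
  | zero => simp [chi_nil_right]
  | succ k ih => rw [List.replicate_succ, chi_cons_right, chi_singleton, hi, ih, one_mul]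

/-- A power `x_i ^ k` with `q i i = 1` need not lie in `𝔏(V)`, but it rotates as if it did: its
letters are rotated one at a time, and contribute no factor for passing each other. -/
theorem monomialClass_rotate_replicate {i : Fin n} (hi : q i i = 1) {k : ℕ} (hk : 2 ≤ k)
    (ih : ∀ w, w.length < (u ++ List.replicate k i).length → ListAdmissible q w →
      listMonomial q w ∈ nicholsBraidedLie q)
    (hu : ListConnectedNontrivial q (u ++ List.replicate k i)) :
    monomialClass q (List.replicate k i ++ u) =
      chi q (List.replicate k i) u • monomialClass q (u ++ List.replicate k i) := by
  have key : ∀ a c, a + c = k → monomialClass q (List.replicate a i ++ (u ++ List.replicate c i)) =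
      chi q (List.replicate a i) u • monomialClass q (u ++ List.replicate k i) := by
    intro a
    induction a with
    | zero => intro c hc; simp [chi_nil_left, ← hc]
    | succ a iha =>
      intro c hc
      set v := List.replicate a i ++ (u ++ List.replicate c i) with hv
      have hmem : ∀ x, x ∈ u ++ List.replicate k i ↔ x ∈ v := by
        intro x
        simp only [hv, List.mem_append, List.mem_replicate]
        have : (a ≠ 0 ∨ c ≠ 0) ∧ k ≠ 0 := by omega
        tauto
      have hvL := ih v (by simp [hv]; omega) (hu.congr hmem).admissible
      have hiL : listMonomial q [i] ∈ nicholsBraidedLie q := by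
        rw [listMonomial_singleton]; exact gen_mem_nicholsBraidedLie q i
      have h1 := monomialClass_bracket hvL hiL
      have h2 := iha (c + 1) (by omega)
      have e : v ++ [i] = List.replicate a i ++ (u ++ List.replicate (c + 1) i) := by
        simp [hv, List.replicate_succ']
      rw [e, h2] at h1
      rw [List.replicate_succ, List.cons_append, ← hv, ← List.singleton_append, h1, smul_smul,
        hv, chi_append_right, chi_append_right, chi_singleton_replicate hi,
        chi_singleton_replicate hi, mul_one, one_mul, chi_cons_left q i (List.replicate a i) u]
  simpa using key k 0 (by omega)

/-- Modulo `𝔏(V)`, a word `v` may be rotated past an admissible word `u` even if `v` is not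
admissible. A disconnected `v` is rotated in two parts that are not joined to each other: the
factors for these parts passing each other cancel. -/
theorem monomialClass_rotate {N : ℕ}
    (ih : ∀ w, w.length < N → ListAdmissible q w → listMonomial q w ∈ nicholsBraidedLie q)
    (v u : List (Fin n)) (hu : ListAdmissible q u) (hN : (u ++ v).length = N)
    (huv : ListConnectedNontrivial q (u ++ v)) :
    monomialClass q (v ++ u) = chi q v u • monomialClass q (u ++ v) := by
  induction hk : v.length using Nat.strong_induction_on generalizing u v with
  | _ k ihk =>
  subst hk
  by_cases hv0 : v = []
  · simp [hv0, chi_nil_left]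
  have hupos : 0 < u.length := List.length_pos_iff.2 hu.1.1
  have hvpos : 0 < v.length := List.length_pos_iff.2 hv0
  rw [List.length_append] at hN
  by_cases hc : ListConnected q v
  · by_cases hg : ListAdmissible q v
    · exact monomialClass_bracket (ih u (by omega) hu) (ih v (by omega) hg)
    · simp only [ListAdmissible, hc, true_and, not_forall, not_or, not_not] at hg
      obtain ⟨i, hi, hl, hq⟩ := hg
      have hrep := List.eq_replicate_of_mem hi
      rw [hrep] at huv ⊢
      exact monomialClass_rotate_replicate hq (by omega)
        (fun w hw => ih w (by simp at hw; omega)) huv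
  · simp only [ListConnected, ne_eq, hv0, not_false_eq_true, true_and] at hc
    push Not at hc
    obtain ⟨P, ⟨a, ha, hPa⟩, ⟨b, hb, hPb⟩, hP⟩ := hc
    obtain ⟨c, hcv⟩ := exists_listMonomial_filter P hP
    have hP' : ∀ a ∈ v, ∀ b ∈ v, (!P a) = true → (!P b) = false → q a b * q b a = 1 := by
      intro a ha b hb h1 h2
      rw [mul_comm]
      exact hP b hb a ha (by simpa using h2) (by simpa using h1)
    have g1 := huv.append_filter hu.1 ⟨a, ha, hPa⟩ hP
    have g2 := huv.append_filter (P := fun x => !P x) hu.1 ⟨b, hb, by simp [hPb]⟩ hP'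
    have hl : v.length = (v.filter P).length + (v.filter fun x => !P x).length := by
      rw [List.length_eq_length_filter_add P]
    have hmem : ∀ x, x ∈ v ↔ x ∈ v.filter P ∨ x ∈ v.filter fun x => !P x := by
      intro x
      cases hx : P x <;> simp [hx]
    have hp1 : 0 < (v.filter P).length := List.length_pos_of_mem (a := a) (by simp [ha, hPa])
    have hp2 : 0 < (v.filter fun x => !P x).length :=
      List.length_pos_of_mem (a := b) (by simp [hb, hPb])
    have hsep : ∀ a ∈ v.filter P, ∀ b ∈ v.filter (fun x => !P x), q a b * q b a = 1 := by
      intro a ha b hb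
      simp only [List.mem_filter, Bool.not_eq_true'] at ha hb
      exact hP a ha.1 b hb.1 ha.2 hb.2
    have hone := chi_mul_chi_eq_one hsep
    have hdeg : listDeg v = listDeg (v.filter P ++ v.filter fun x => !P x) := by
      funext x
      exact ((List.filter_append_perm P v).count_eq x).symm
    set v₁ := v.filter P
    set v₂ := v.filter fun x => !P x
    have r1 := ihk v₂.length (by omega) v₂ (u ++ v₁) g1.admissible (by simp; omega)
      (huv.congr fun x => by simp [hmem]) rfl
    have r2 := ihk v₁.length (by omega) v₁ (v₂ ++ u)
      (g2.congr fun x => by simp [or_comm]).admissible (by simp; omega)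
      (huv.congr fun x => by simp [hmem]; tauto) rfl
    have s1 : monomialClass q (v ++ u) = c • monomialClass q (v₁ ++ (v₂ ++ u)) :=
      monomialClass_of_smul (by
        rw [listMonomial_append, hcv, smul_mul_assoc, ← listMonomial_append, List.append_assoc])
    have s2 : monomialClass q (u ++ v) = c • monomialClass q (u ++ v₁ ++ v₂) :=
      monomialClass_of_smul (by
        rw [listMonomial_append, hcv, mul_smul_comm, ← listMonomial_append, List.append_assoc])
    have hchi : chi q v u = chi q (v₁ ++ v₂) u := by rw [chi, hdeg]; rfl
    rw [s1, s2, r2, List.append_assoc v₂ u v₁, r1, hchi]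
    simp only [smul_smul, chi_append_left, chi_append_right]
    congr 1
    calc _ = c * (chi q v₁ u * chi q v₂ u) * (chi q v₁ v₂ * chi q v₂ v₁) := by
          simp only [mul_comm, mul_left_comm]
      _ = _ := by rw [hone, mul_one, mul_comm]

/-- The vanishing of the class of a word in `𝔅(V) / 𝔏(V)` is invariant under rotation. -/
theorem monomialClass_append_eq_zero {N : ℕ}
    (ih : ∀ w, w.length < N → ListAdmissible q w → listMonomial q w ∈ nicholsBraidedLie q)
    (hN : (u ++ v).length = N) (huv : ListConnectedNontrivial q (u ++ v))
    (h : monomialClass q (v ++ u) = 0) : monomialClass q (u ++ v) = 0 := by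
  induction u generalizing v with
  | nil => simpa using h
  | cons x u ihu =>
    have h0 := ihu (v := v ++ [x]) (by simp at hN ⊢; omega)
      (huv.congr fun y => by simp; tauto) (by simpa using h)
    have h1 := monomialClass_rotate ih (u ++ v) [x] (listAdmissible_singleton q x)
      (by simpa using hN) huv
    rw [List.append_assoc, h0, eq_comm, smul_eq_zero_iff_eq] at h1
    exact h1

/-- The letters `i`, `j` can be rotated to the end of `i j v` one by one or as the block `i j`; the
two resulting factors differ by `q i j * q j i`. -/
theorem monomialClass_cons_cons_eq_zero {N : ℕ}
    (ih : ∀ w, w.length < N → ListAdmissible q w → listMonomial q w ∈ nicholsBraidedLie q)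
    {i j : Fin n} (hij : q i j * q j i ≠ 1) (hN : (i :: j :: v).length = N)
    (hv : ListConnectedNontrivial q (i :: j :: v)) : monomialClass q (i :: j :: v) = 0 := by
  have h1 := monomialClass_rotate ih (j :: v) [i] (listAdmissible_singleton q i) hN hv
  have h2 := monomialClass_rotate ih (v ++ [i]) [j] (listAdmissible_singleton q j)
    (by simpa using hN) (hv.congr fun y => by simp; tauto)
  have h3 := monomialClass_rotate ih v [i, j] (listAdmissible_pair hij) hN hv
  simp only [List.append_assoc, List.cons_append, List.nil_append] at h1 h2 h3
  rw [h1, h3, smul_smul, chi_append_left, chi_cons_left q j v, chi_cons_right q i [j],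
    chi_singleton, chi_singleton] at h2
  by_contra hne
  rw [Units.smul_def, Units.smul_def] at h2
  have h4 := Units.ext (smul_left_injective F hne h2)
  apply hij
  have h5 : chi q v [i] * chi q v [j] * (q i j * q j i) = chi q v [i] * chi q v [j] * 1 := by
    rw [mul_one]
    refine Eq.trans ?_ h4.symm
    simp only [mul_comm, mul_left_comm, mul_assoc]
  exact mul_left_cancel h5

theorem chi_replicate_singleton (q : Fin n → Fin n → Fˣ) (i : Fin n) (k : ℕ) :
    chi q (List.replicate k i) [i] = q i i ^ k := by
  induction k with
  | zero => simp [chi_nil_left]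
  | succ k ih => rw [List.replicate_succ, chi_cons_left, chi_singleton, ih, pow_succ']

theorem gen_pow_mem_nicholsBraidedLie {i : Fin n} (hi : q i i ≠ 1) (k : ℕ) :
    gen q i ^ (k + 1) ∈ nicholsBraidedLie q := by
  induction k with
  | zero => simpa using gen_mem_nicholsBraidedLie q i
  | succ k ih =>
    by_cases hk : q i i ^ (k + 1) = 1
    · rw [pow_succ, gen_pow_eq_zero q hi k.succ_pos hk, zero_mul]
      exact Submodule.zero_mem _
    · rw [← listMonomial_replicate] at ih ⊢
      have h := monomialClass_bracket (u := [i])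
        (by rw [listMonomial_singleton]; exact gen_mem_nicholsBraidedLie q i) ih
      rw [← List.replicate_succ', List.singleton_append, ← List.replicate_succ,
        chi_replicate_singleton] at h
      rw [← monomialClass_eq_zero]
      by_contra hne
      refine hk (Units.ext (smul_left_injective F hne ?_))
      rw [Units.smul_def] at h
      simpa using h.symm

/-- The monomial of an admissible word lies in `𝔏(V)`, even if it vanishes. -/
theorem ListAdmissible.listMonomial_mem (hw : ListAdmissible q w) :
    listMonomial q w ∈ nicholsBraidedLie q := by
  induction hN : w.length using Nat.strong_induction_on generalizing w with
  | _ N ihN =>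
  have ih : ∀ w, w.length < N → ListAdmissible q w → listMonomial q w ∈ nicholsBraidedLie q :=
    fun v hv hv' => ihN _ hv hv' rfl
  by_cases hs : ∃ i, ∀ x ∈ w, x = i
  · obtain ⟨i, hi⟩ := hs
    obtain ⟨k, hk⟩ := Nat.exists_eq_succ_of_ne_zero (List.length_pos_iff.2 hw.1.1).ne'
    rw [List.eq_replicate_of_mem hi, listMonomial_replicate, hk]
    rcases hw.2 i hi with h | h
    · obtain rfl : k = 0 := by omega
      simpa using gen_mem_nicholsBraidedLie q i
    · exact gen_pow_mem_nicholsBraidedLie h k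
  · have hw' : ListConnectedNontrivial q w := ⟨hw.1, by simpa using hs⟩
    obtain ⟨a, i, z, j, c, rfl, hij, hz⟩ := exists_factorization_of_edge hw'.not_pairwise
    have hcomm : listMonomial q (a ++ i :: (z ++ j :: c)) =
        chi q [i] z • listMonomial q ((a ++ z) ++ i :: j :: c) := by
      have h := listMonomial_cons_comm hz
      have e1 : i :: (z ++ j :: c) = (i :: z) ++ j :: c := rfl
      have e2 : (a ++ z) ++ i :: j :: c = a ++ ((z ++ [i]) ++ j :: c) := by simp
      rw [e1, e2, listMonomial_append, listMonomial_append, h, listMonomial_append q a,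
        listMonomial_append q (z ++ [i]), smul_mul_assoc, mul_smul_comm]
    rw [← monomialClass_eq_zero, monomialClass_of_smul hcomm,
      monomialClass_append_eq_zero ih, smul_zero]
    · rw [← hN]; simp; omega
    · exact hw'.congr fun x => by simp; tauto
    · refine monomialClass_cons_cons_eq_zero ih hij ?_ (hw'.congr fun x => by simp; tauto)
      rw [← hN]; simp; omega

end Words

/-! ### The grading of the Nichols algebra -/

theorem wordDeg_comp_perm {m : ℕ} (h : Fin m → Fin n) (σ : Equiv.Perm (Fin m)) :
    wordDeg (h ∘ σ) = wordDeg h :=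
  funext fun _ => Fintype.card_congr (σ.subtypeEquiv fun _ => Iff.rfl)

theorem braidOp_filter (q : Fin n → Fin n → Fˣ) {m : ℕ} (σ : Equiv.Perm (Fin m))
    (t : TensorPow F n m) (α : Fin n → ℕ) :
    braidOp q σ (t.filter fun h => wordDeg h = α) =
      (braidOp q σ t).filter fun h => wordDeg h = α := by
  induction t using Finsupp.induction_linear with
  | zero => simp only [Finsupp.filter_zero, map_zero]
  | add s t hs ht => rw [Finsupp.filter_add, map_add, map_add, Finsupp.filter_add, hs, ht]
  | single h c =>
    by_cases hα : wordDeg h = α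
    · rw [Finsupp.filter_single_of_pos (fun h => wordDeg h = α) hα, braidOp,
        Finsupp.linearCombination_single,
        Finsupp.filter_smul, Finsupp.filter_smul, Finsupp.filter_single_of_pos]
      rw [wordDeg_comp_perm, hα]
    · rw [Finsupp.filter_single_of_neg (fun h => wordDeg h = α) hα, map_zero, braidOp,
        Finsupp.linearCombination_single,
        Finsupp.filter_smul, Finsupp.filter_smul, Finsupp.filter_single_of_neg, smul_zero,
        smul_zero]
      rwa [wordDeg_comp_perm]

theorem quantumSymmetrizer_filter (q : Fin n → Fin n → Fˣ) {m : ℕ}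
    (t : TensorPow F n m) (α : Fin n → ℕ) :
    quantumSymmetrizer q m (t.filter fun h => wordDeg h = α) =
      (quantumSymmetrizer q m t).filter fun h => wordDeg h = α := by
  simp only [quantumSymmetrizer, LinearMap.sum_apply, braidOp_filter]
  exact (map_sum (Finsupp.filterAddHom (M := F) fun h : Fin m → Fin n => wordDeg h = α) _ _).symm

/-- The algebra map `T(V) → 𝔅(V)[ℕ^n]` which attaches to a homogeneous element its degree. -/
noncomputable def freeCoaction (q : Fin n → Fin n → Fˣ) :
    FreeAlgebra F (Fin n) →ₐ[F] AddMonoidAlgebra (NicholsAlgebra q) (Fin n → ℕ) :=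
  FreeAlgebra.lift F fun i => AddMonoidAlgebra.single (listDeg [i]) (gen q i)

theorem freeCoaction_list (q : Fin n → Fin n → Fˣ) (w : List (Fin n)) :
    freeCoaction q (w.map (FreeAlgebra.ι F)).prod =
      AddMonoidAlgebra.single (listDeg w) (listMonomial q w) := by
  induction w with
  | nil => simp [listMonomial, AddMonoidAlgebra.one_def]; rfl
  | cons i w ih =>
    rw [List.map_cons, List.prod_cons, map_mul, ih, freeCoaction, FreeAlgebra.lift_ι_apply,
      AddMonoidAlgebra.single_mul_single, ← listDeg_append, listMonomial_cons]
    rfl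

theorem coeff_freeCoaction_toTensorAlgebra (q : Fin n → Fin n → Fˣ) {m : ℕ}
    (t : TensorPow F n m) (α : Fin n → ℕ) :
    (freeCoaction q (toTensorAlgebra m t)).coeff α =
      RingQuot.mkAlgHom F (NicholsRel q)
        (toTensorAlgebra m (t.filter fun h => wordDeg h = α)) := by
  induction t using Finsupp.induction_linear with
  | zero => rw [Finsupp.filter_zero, map_zero, map_zero, map_zero]; rfl
  | add s t hs ht =>
    rw [Finsupp.filter_add, map_add, map_add, map_add, map_add, ← hs, ← ht]
    rfl
  | single h c =>
    have h1 : freeCoaction q (toTensorAlgebra m (Finsupp.single h c)) =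
        c • AddMonoidAlgebra.single (wordDeg h) (monomial q h) := by
      rw [toTensorAlgebra, Finsupp.linearCombination_single, map_smul]
      have := freeCoaction_list q (List.ofFn h)
      rw [List.map_ofFn, listMonomial_ofFn, ← wordDeg_eq_listDeg] at this
      rw [← this]
      rfl
    rw [h1, AddMonoidAlgebra.coeff_smul, AddMonoidAlgebra.coeff_single, Finsupp.smul_apply]
    by_cases hα : wordDeg h = α
    · rw [Finsupp.filter_single_of_pos (fun h => wordDeg h = α) hα,
        mkAlgHom_toTensorAlgebra_single, hα,
        Finsupp.single_eq_same]
    · rw [Finsupp.filter_single_of_neg (fun h => wordDeg h = α) hα, map_zero, map_zero,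
        Finsupp.single_eq_of_ne (Ne.symm hα), smul_zero]

/-- The coaction `𝔅(V) → 𝔅(V)[ℕ^n]` which attaches to a homogeneous element its degree. It exists
because the quantum symmetrizers preserve the multidegree. -/
noncomputable def coaction (q : Fin n → Fin n → Fˣ) :
    NicholsAlgebra q →ₐ[F] AddMonoidAlgebra (NicholsAlgebra q) (Fin n → ℕ) :=
  RingQuot.liftAlgHom F ⟨freeCoaction q, by
    rintro _ _ ⟨m, t, ht⟩
    rw [map_zero]
    apply AddMonoidAlgebra.coeff_injective
    refine Finsupp.ext fun α => ?_
    rw [coeff_freeCoaction_toTensorAlgebra, mkAlgHom_toTensorAlgebra_eq_zero]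
    · rfl
    · rw [quantumSymmetrizer_filter, ht, Finsupp.filter_zero]⟩

theorem coaction_listMonomial (q : Fin n → Fin n → Fˣ) (w : List (Fin n)) :
    coaction q (listMonomial q w) = AddMonoidAlgebra.single (listDeg w) (listMonomial q w) := by
  rw [← freeCoaction_list]
  have : listMonomial q w =
      RingQuot.mkAlgHom F (NicholsRel q) (w.map (FreeAlgebra.ι F)).prod := by
    rw [map_list_prod, List.map_map]
    rfl
  rw [this, coaction, RingQuot.liftAlgHom_mkAlgHom_apply]

theorem coaction_of_mem {q : Fin n → Fin n → Fˣ} {α : Fin n → ℕ} {u : NicholsAlgebra q}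
    (hu : u ∈ homogeneousPart q α) : coaction q u = AddMonoidAlgebra.single α u := by
  rw [homogeneousPart_eq_span] at hu
  induction hu using Submodule.span_induction with
  | mem x hx =>
    obtain ⟨w, rfl, rfl⟩ := hx
    exact coaction_listMonomial q w
  | zero => rw [map_zero, AddMonoidAlgebra.single_zero]
  | add x y _ _ hx hy => rw [map_add, hx, hy, AddMonoidAlgebra.single_add]
  | smul c x _ hx => rw [map_smul, hx, AddMonoidAlgebra.smul_single]

/-- The projection of the Nichols algebra onto its homogeneous component of multidegree `α`. -/
noncomputable def homogeneousProj (q : Fin n → Fin n → Fˣ) (α : Fin n → ℕ) :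
    NicholsAlgebra q →ₗ[F] NicholsAlgebra q where
  toFun u := (coaction q u).coeff α
  map_add' u v := by rw [map_add]; rfl
  map_smul' c u := by rw [map_smul]; rfl

theorem homogeneousProj_of_mem {q : Fin n → Fin n → Fˣ} {α : Fin n → ℕ} {u : NicholsAlgebra q}
    (hu : u ∈ homogeneousPart q α) : homogeneousProj q α u = u := by
  change (coaction q u).coeff α = u
  rw [coaction_of_mem hu, AddMonoidAlgebra.coeff_single, Finsupp.single_eq_same]

theorem homogeneousProj_of_mem_of_ne {q : Fin n → Fin n → Fˣ} {α β : Fin n → ℕ}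
    {u : NicholsAlgebra q} (hu : u ∈ homogeneousPart q α) (h : β ≠ α) :
    homogeneousProj q β u = 0 := by
  change (coaction q u).coeff β = 0
  rw [coaction_of_mem hu, AddMonoidAlgebra.coeff_single, Finsupp.single_eq_of_ne h]

/-! ### Disconnected degrees -/

theorem mem_iff_of_listDeg_eq {u v : List (Fin n)} (h : listDeg u = listDeg v) (x : Fin n) :
    x ∈ u ↔ x ∈ v := by
  rw [← List.count_pos_iff, ← List.count_pos_iff]
  exact iff_of_eq (congrArg (0 < ·) (congrFun h x))

/-- The sum of all homogeneous components of connected multidegree: the elements whose projections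
to the disconnected multidegrees vanish. -/
noncomputable def connectedPart (q : Fin n → Fin n → Fˣ) : Submodule F (NicholsAlgebra q) :=
  ⨅ (w : List (Fin n)) (_ : ¬ ListConnected q w), LinearMap.ker (homogeneousProj q (listDeg w))

theorem mem_connectedPart {q : Fin n → Fin n → Fˣ} {u : NicholsAlgebra q} :
    u ∈ connectedPart q ↔ ∀ w, ¬ ListConnected q w → homogeneousProj q (listDeg w) u = 0 := by
  simp [connectedPart]

/-- Two connected words either have a connected product or are not joined to each other. -/
theorem ListConnected.append {q : Fin n → Fin n → Fˣ} {u v : List (Fin n)}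
    (hu : ListConnected q u) (hv : ListConnected q v)
    (h : (∃ x ∈ u, x ∈ v) ∨ ∃ a ∈ u, ∃ b ∈ v, q a b * q b a ≠ 1) : ListConnected q (u ++ v) := by
  refine ⟨by simp [hu.1], fun P h1 h2 => ?_⟩
  by_contra! hno
  -- A partition without a crossing edge is constant on `u` and on `v`.
  have const : ∀ w, ListConnected q w → (∀ x ∈ w, x ∈ u ++ v) →
      (∀ x ∈ w, P x = true) ∨ ∀ x ∈ w, P x = false := by
    intro w hw hsub
    by_contra! hcon
    obtain ⟨⟨x, hx, hPx⟩, y, hy, hPy⟩ := hcon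
    obtain ⟨a, ha, b, hb, hPa, hPb, hab⟩ :=
      hw.2 P ⟨y, hy, by simpa using hPy⟩ ⟨x, hx, by simpa using hPx⟩
    exact hab (hno a (hsub a ha) b (hsub b hb) hPa hPb)
  have cross : ∀ a ∈ u, ∀ b ∈ v, P a ≠ P b → a ≠ b ∧ q a b * q b a = 1 := by
    intro a ha b hb hab
    refine ⟨by rintro rfl; exact hab rfl, ?_⟩
    cases hPa : P a
    · rw [mul_comm]
      exact hno b (by simp [hb]) a (by simp [ha]) (by simpa [hPa] using hab.symm) hPa
    · exact hno a (by simp [ha]) b (by simp [hb]) hPa (by simpa [hPa] using hab.symm)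
  have contra : (∀ a ∈ u, ∀ b ∈ v, P a ≠ P b) → False := by
    intro hPP
    rcases h with ⟨x, hxu, hxv⟩ | ⟨a, ha, b, hb, hab⟩
    · exact hPP x hxu x hxv rfl
    · exact hab (cross a ha b hb (hPP a ha b hb)).2
  obtain ⟨x, hx, hPx⟩ := h1
  obtain ⟨y, hy, hPy⟩ := h2
  rw [List.mem_append] at hx hy
  rcases const u hu (by simp +contextual) with hcu | hcu <;>
    rcases const v hv (by simp +contextual) with hcv | hcv
  · rcases hy with hy | hy
    · simp [hcu y hy] at hPy
    · simp [hcv y hy] at hPy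
  · exact contra fun a ha b hb => by simp [hcu a ha, hcv b hb]
  · exact contra fun a ha b hb => by simp [hcu a ha, hcv b hb]
  · rcases hx with hx | hx
    · simp [hcu x hx] at hPx
    · simp [hcv x hx] at hPx

/-- The bracket of homogeneous elements vanishes if their degrees are not joined to each other. -/
theorem bracket_eq_zero {q : Fin n → Fin n → Fˣ} {u v : List (Fin n)} {x y : NicholsAlgebra q}
    (hx : x ∈ homogeneousPart q (listDeg u)) (hy : y ∈ homogeneousPart q (listDeg v))
    (h : ∀ b ∈ v, ∀ a ∈ u, q b a * q a b = 1) :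
    y * x = (chi q v u : F) • (x * y) := by
  rw [homogeneousPart_eq_span] at hx hy
  induction hx, hy using Submodule.span_induction₂ with
  | mem_mem x y hx hy =>
    obtain ⟨w, hw, rfl⟩ := hx
    obtain ⟨z, hz, rfl⟩ := hy
    rw [← listMonomial_append, ← listMonomial_append, chi, ← hw, ← hz]
    exact listMonomial_append_comm fun b hb a ha =>
      h b ((mem_iff_of_listDeg_eq hz b).1 hb) a ((mem_iff_of_listDeg_eq hw a).1 ha)
  | zero_left y hy => simp
  | zero_right x hx => simp
  | add_left x y z _ _ _ h1 h2 => rw [mul_add, add_mul, smul_add, h1, h2]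
  | add_right x y z _ _ _ h1 h2 => rw [mul_add, add_mul, smul_add, h1, h2]
  | smul_left c x y _ _ h1 => rw [mul_smul_comm, smul_mul_assoc, h1, smul_comm]
  | smul_right c x y _ _ h1 => rw [mul_smul_comm, smul_mul_assoc, h1, smul_comm]

theorem mul_mem_homogeneousPart {q : Fin n → Fin n → Fˣ} {α β : Fin n → ℕ}
    {x y : NicholsAlgebra q} (hx : x ∈ homogeneousPart q α) (hy : y ∈ homogeneousPart q β) :
    x * y ∈ homogeneousPart q (α + β) := by
  rw [homogeneousPart_eq_span] at hx hy
  induction hx, hy using Submodule.span_induction₂ with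
  | mem_mem x y hx hy =>
    obtain ⟨w, rfl, rfl⟩ := hx
    obtain ⟨z, rfl, rfl⟩ := hy
    rw [← listMonomial_append, ← listDeg_append]
    exact listMonomial_mem_homogeneousPart q _
  | zero_left y hy => simp
  | zero_right x hx => simp
  | add_left x y z _ _ _ h1 h2 => rw [add_mul]; exact add_mem h1 h2
  | add_right x y z _ _ _ h1 h2 => rw [mul_add]; exact add_mem h1 h2
  | smul_left c x y _ _ h1 => rw [smul_mul_assoc]; exact Submodule.smul_mem _ c h1
  | smul_right c x y _ _ h1 => rw [mul_smul_comm]; exact Submodule.smul_mem _ c h1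

theorem exists_listDeg_eq (α : Fin n → ℕ) : ∃ w : List (Fin n), listDeg w = α := by
  refine ⟨(List.finRange n).flatMap fun i => List.replicate (α i) i, funext fun j => ?_⟩
  simp only [listDeg, List.count_flatMap, Function.comp_def, List.count_replicate]
  rw [← List.ofFn_eq_map, List.sum_ofFn]
  simp

theorem nicholsBraidedLie_le_connectedPart (q : Fin n → Fin n → Fˣ) :
    nicholsBraidedLie q ≤ connectedPart q := by
  refine sInf_le ⟨fun i => ?_, ?_⟩
  · rw [mem_connectedPart, ← listMonomial_singleton]
    intro w hw
    refine homogeneousProj_of_mem_of_ne (listMonomial_mem_homogeneousPart q [i]) fun h => hw ?_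
    exact (listAdmissible_singleton q i).1.congr (mem_iff_of_listDeg_eq h.symm)
  · intro α β x y hx hy hxα hyβ
    obtain ⟨u, rfl⟩ := exists_listDeg_eq α
    obtain ⟨v, rfl⟩ := exists_listDeg_eq β
    rw [mem_connectedPart] at *
    intro w hw
    have hmem : y * x - (bichar q (listDeg v) (listDeg u) : F) • (x * y) ∈
        homogeneousPart q (listDeg (u ++ v)) := by
      rw [listDeg_append]
      refine sub_mem ?_ (Submodule.smul_mem _ _ (mul_mem_homogeneousPart hxα hyβ))
      rw [add_comm]
      exact mul_mem_homogeneousPart hyβ hxα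
    by_cases hwuv : listDeg w = listDeg (u ++ v)
    · suffices h0 : y * x - (bichar q (listDeg v) (listDeg u) : F) • (x * y) = 0 by
        rw [h0, map_zero]
      by_cases hu : ListConnected q u
      · by_cases hv : ListConnected q v
        · rw [sub_eq_zero]
          refine bracket_eq_zero hxα hyβ fun b hb a ha => ?_
          by_contra hab
          refine hw ((hu.append hv (Or.inr ⟨a, ha, b, hb, by rwa [mul_comm]⟩)).congr
            (mem_iff_of_listDeg_eq hwuv.symm))
        · have := hy v hv
          rw [homogeneousProj_of_mem hyβ] at this
          simp [this]
      · have := hx u hu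
        rw [homogeneousProj_of_mem hxα] at this
        simp [this]
    · exact homogeneousProj_of_mem_of_ne hmem hwuv

theorem listConnected_of_mem_nicholsBraidedLie {q : Fin n → Fin n → Fˣ} {w : List (Fin n)}
    (hw : listMonomial q w ∈ nicholsBraidedLie q) (h0 : listMonomial q w ≠ 0) :
    ListConnected q w := by
  by_contra hc
  have := mem_connectedPart.1 (nicholsBraidedLie_le_connectedPart q hw) w hc
  rw [homogeneousProj_of_mem (listMonomial_mem_homogeneousPart q w)] at this
  exact h0 this

/-! ### Comparison with connectedness of the Dynkin graph -/

theorem listConnected_ofFn_iff (q : Fin n → Fin n → Fˣ) {m : ℕ} (h : Fin m → Fin n) :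
    ListConnected q (List.ofFn h) ↔ LettersConnected q h := by
  have hmem : ∀ x, x ∈ List.ofFn h ↔ x ∈ Set.range h := fun x => by
    rw [List.mem_ofFn', Set.mem_range]
  constructor
  · intro hc
    obtain ⟨y, hy⟩ := List.exists_mem_of_ne_nil _ hc.1
    rw [LettersConnected, SimpleGraph.connected_iff_exists_forall_reachable]
    refine ⟨⟨y, (hmem y).1 hy⟩, ?_⟩
    by_contra! hnot
    obtain ⟨z, hz⟩ := hnot
    classical
    -- The component of `y` is a class of a partition without crossing edges.
    obtain ⟨a, ha, b, hb, hPa, hPb, hab⟩ := hc.2 (fun x => decide (∃ hx : x ∈ Set.range h,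
      ((pureDynkinGraph q).induce (Set.range h)).Reachable ⟨y, (hmem y).1 hy⟩ ⟨x, hx⟩))
      ⟨y, hy, decide_eq_true ⟨_, SimpleGraph.Reachable.refl _⟩⟩
      ⟨z, (hmem z).2 z.2, decide_eq_false fun ⟨_, h⟩ => hz h⟩
    simp only [decide_eq_true_eq, decide_eq_false_iff_not] at hPa hPb
    obtain ⟨ha', hra⟩ := hPa
    refine hPb ⟨(hmem b).1 hb, hra.trans (SimpleGraph.Adj.reachable ⟨?_, hab⟩)⟩
    rintro heq
    have heq' : a = b := heq
    subst heq'
    exact hPb ⟨ha', hra⟩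
  · intro hc
    have hc' : ((pureDynkinGraph q).induce (Set.range h)).Connected := hc
    obtain ⟨⟨y, hy⟩⟩ := hc'.nonempty
    refine ⟨List.ne_nil_of_mem ((hmem y).2 hy), ?_⟩
    rintro P ⟨a, ha, hPa⟩ ⟨b, hb, hPb⟩
    obtain ⟨p⟩ := hc'.preconnected ⟨a, (hmem a).1 ha⟩ ⟨b, (hmem b).1 hb⟩
    obtain ⟨d, -, h1, h2⟩ := p.exists_boundary_dart {x | P x.1 = true} hPa (by simp [hPb])
    exact ⟨d.fst, (hmem _).2 d.fst.2, d.snd, (hmem _).2 d.snd.2, h1, by simpa using h2, d.adj.2⟩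

end DiagonalBraiding

theorem corollary2p5 {F : Type*} [Field F] [IsAlgClosed F] [CharZero F] {n : ℕ}
    (q : Fin n → Fin n → Fˣ) {m : ℕ} (hm : 0 < m) (h : Fin m → Fin n)
    (hp : Set.range h = {h ⟨0, hm⟩} → q (h ⟨0, hm⟩) (h ⟨0, hm⟩) ≠ 1) :
    (DiagonalBraiding.monomial q h ≠ 0 →
      (DiagonalBraiding.monomial q h ∈ DiagonalBraiding.nicholsBraidedLie q ↔
        DiagonalBraiding.LettersConnected q h)) ∧
    (DiagonalBraiding.LettersConnected q h →
      DiagonalBraiding.monomial q h ∈ DiagonalBraiding.nicholsBraidedLie q) := by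
  have hmem : DiagonalBraiding.LettersConnected q h →
      DiagonalBraiding.monomial q h ∈ DiagonalBraiding.nicholsBraidedLie q := by
    intro hc
    rw [← DiagonalBraiding.listMonomial_ofFn]
    refine DiagonalBraiding.ListAdmissible.listMonomial_mem
      ⟨(DiagonalBraiding.listConnected_ofFn_iff q h).2 hc, fun i hi => Or.inr ?_⟩
    have hi' : ∀ k, h k = i := fun k => hi _ (by simp [List.mem_ofFn'])
    rw [← hi' ⟨0, hm⟩]
    refine hp (Set.eq_singleton_iff_unique_mem.2 ⟨⟨_, rfl⟩, ?_⟩)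
    rintro _ ⟨k, rfl⟩
    rw [hi', hi']
  refine ⟨fun h0 => ⟨fun hL => ?_, hmem⟩, hmem⟩
  rw [← DiagonalBraiding.listMonomial_ofFn] at h0 hL
  exact (DiagonalBraiding.listConnected_ofFn_iff q h).1
    (DiagonalBraiding.listConnected_of_mem_nicholsBraidedLie hL h0)
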